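/- Let $0<q<1$ and let $U_q\mathfrak{sl}_2$ be the complex algebra with generators $K^{\pm1},E,F$ and relations $KK^{-1}=K^{-1}K=1$, $K^{\pm1}E=q^{\pm2}EK^{\pm1}$, $K^{\pm1}F=q^{\mp2}FK^{\pm1}$, $EF-FE=(K-K^{-1})/(q-q^{-1})$, with coproduct $\Delta(K)=K\otimes K$, $\Delta(E)=E\otimes1+K\otimes E$, $\Delta(F)=F\otimes K^{-1}+1\otimes F$. Put $$\Omega=FE+\frac{q^{-1}K^{-1}+qK-(q^{-1}+q)}{(q^{-1}-q)^2}.$$ Let $\mathrm{Pol}(\mathbb C)_q$ be the $*$-algebra generated by $z,z^*$ with $z^*z=q^2zz^*+1-q^2$. It is a $U_q\mathfrak{sl}_2$-module algebra via $K^{\pm1}z=q^{\pm2}z$, $Fz=q^{1/2}$, $Ez=-q^{1/2}z^2$, $K^{\pm1}z^*=q^{\mp2}z^*$, $Ez^*=q^{-3/2}$, $Fz^*=-q^{5/2}z^{*2}$. Let $D(U)_q'$ be the $\mathrm{Pol}(\mathbb C)_q$-bimodule of formal series $\sum_{j,k\ge0}a_{jk}z^jz^{*k}$, with the $U_q\mathfrak{sl}_2$-action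 extended coefficientwise, and let $D(U)_q=\{f\in D(U)_q' : z^{*N}f=fz^N=0\text{ for some }N\}$, a submodule. In $\ell^2(\mathbb Z_+)$ let $ze_n=(1-q^{2(n+1)})^{1/2}e_{n+1}$, $z^*e_n=(1-q^{2n})^{1/2}e_{n-1}$; taking matrices $(l_{mn}(f))$ in the basis $(e_n)$ identifies $D(U)_q$ with the $*$-algebra of matrices with finitely many nonzero entries. Put $\int f\,d\nu=(1-q^2)\sum_{j\ge0}l_{jj}(f)q^{-2j}$. Let $L^2(d\nu)_q$ be the completion of $D(U)_q$ in the scalar product $(f_1,f_2)=\int f_2^*f_1\,d\nu$, and $L^2(d\mu)_q$ the completion of the space $\Omega(U)_q^{(0,1)}$ of forms $f\,dz^*$, $f\in D(U)_q$, in the scalar product $(f_1dz^*,f_2dz^*)=\int f_2^*f_1(1-zz^*)^2\,d\nu$. Let $\bar\partial:D(U)_q\to\Omega(U)_q^{(0,1)}$ be given by $\bar\partial\big(\sum a_{jk}z^jz^{*k}\big)=\sum a_{jk}(1+q^{-2}+\dots+q^{-2(k-1)})z^jz^{*(k-1)}dz^*$ (the derivation with $\bar\partial z=0$, $\bar\partial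 z^*=dz^*$, where $dz^*\,z=q^2z\,dz^*$ and $dz^*\,z^*=q^{-2}z^*dz^*$). It extends to a bounded operator $\bar\partial:L^2(d\nu)_q\to L^2(d\mu)_q$; put $\Box=-\bar\partial^*\bar\partial$. Then for every $f\in D(U)_q$ one has $$q\,\Box f=\Omega f .$$ -/

import Mathlib

open scoped ComplexConjugate

noncomputable section

namespace QuantumDisc

/-! ### The algebra `U_q sl₂` and its Casimir element

Throughout `q : Set.Ioo (0 : ℝ) 1` is the deformation parameter. -/

/-- The generators of `U_q sl₂`; `K'` stands for `K⁻¹`. -/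
inductive Gen where
  | K | K' | E | F

/-- The deformation parameter as a complex number. -/
abbrev qc (q : Set.Ioo (0 : ℝ) 1) : ℂ := ((q : ℝ) : ℂ)

/-- `q ^ (1/2)` as a complex number. -/
def qs (q : Set.Ioo (0 : ℝ) 1) : ℂ := ((Real.sqrt (q : ℝ) : ℝ) : ℂ)

open FreeAlgebra in
/-- The defining relations of `U_q sl₂`. -/
inductive Rel (q : Set.Ioo (0 : ℝ) 1) : FreeAlgebra ℂ Gen → FreeAlgebra ℂ Gen → Prop
  | KK' : Rel q (ι ℂ Gen.K * ι ℂ Gen.K') 1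
  | K'K : Rel q (ι ℂ Gen.K' * ι ℂ Gen.K) 1
  | KE : Rel q (ι ℂ Gen.K * ι ℂ Gen.E) ((qc q ^ 2) • (ι ℂ Gen.E * ι ℂ Gen.K))
  | K'E : Rel q (ι ℂ Gen.K' * ι ℂ Gen.E) ((qc q ^ 2)⁻¹ • (ι ℂ Gen.E * ι ℂ Gen.K'))
  | KF : Rel q (ι ℂ Gen.K * ι ℂ Gen.F) ((qc q ^ 2)⁻¹ • (ι ℂ Gen.F * ι ℂ Gen.K))
  | K'F : Rel q (ι ℂ Gen.K' * ι ℂ Gen.F) ((qc q ^ 2) • (ι ℂ Gen.F * ι ℂ Gen.K'))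
  | EF : Rel q (ι ℂ Gen.E * ι ℂ Gen.F - ι ℂ Gen.F * ι ℂ Gen.E)
      ((qc q - (qc q)⁻¹)⁻¹ • (ι ℂ Gen.K - ι ℂ Gen.K'))

/-- The algebra `U_q sl₂`, by generators and relations. -/
abbrev Uq (q : Set.Ioo (0 : ℝ) 1) : Type := RingQuot (Rel q)

/-- The class of a generator in `U_q sl₂`. -/
def gen (q : Set.Ioo (0 : ℝ) 1) (g : Gen) : Uq q :=
  RingQuot.mkAlgHom ℂ (Rel q) (FreeAlgebra.ι ℂ g)

/-- The quantum Casimir element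
`Ω = F E + (q⁻¹ K⁻¹ + q K - (q⁻¹ + q)) / (q⁻¹ - q) ^ 2`. -/
def casimir (q : Set.Ioo (0 : ℝ) 1) : Uq q :=
  gen q .F * gen q .E + (((qc q)⁻¹ - qc q) ^ 2)⁻¹ •
    ((qc q)⁻¹ • gen q .K' + qc q • gen q .K - ((qc q)⁻¹ + qc q) • (1 : Uq q))

/-! ### Distributions in the quantum disc -/

/-- Distributions in the quantum disc: the function `a` stands for the formal series
`∑ a j k z ^ j z* ^ k`. Finite sums form the algebra `Pol(ℂ)_q`, in which
`z* z = q ^ 2 z z* + 1 - q ^ 2`, so that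
`z* z ^ j = q ^ (2 j) z ^ j z* + (1 - q ^ (2 j)) z ^ (j - 1)` and
`z* ^ k z = q ^ (2 k) z z* ^ k + (1 - q ^ (2 k)) z* ^ (k - 1)`. -/
abbrev Distr : Type := ℕ → ℕ → ℂ

/-- Left multiplication by `z`. -/
def lZ : Distr →ₗ[ℂ] Distr where
  toFun a := fun j k => match j with
    | 0 => 0
    | i + 1 => a i k
  map_add' a b := by ext j k; cases j <;> simp
  map_smul' c a := by ext j k; cases j <;> simp

/-- Right multiplication by `z*`. -/
def rZs : Distr →ₗ[ℂ] Distr where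
  toFun a := fun j k => match k with
    | 0 => 0
    | i + 1 => a j i
  map_add' a b := by ext j k; cases k <;> simp
  map_smul' c a := by ext j k; cases k <;> simp

/-- Left multiplication by `z*`. -/
def lZs (q : Set.Ioo (0 : ℝ) 1) : Distr →ₗ[ℂ] Distr where
  toFun a := fun j k =>
    qc q ^ (2 * j) * rZs a j k + (1 - qc q ^ (2 * (j + 1))) * a (j + 1) k
  map_add' a b := by ext j k; simp; ring
  map_smul' c a := by ext j k; simp; ring

/-- Right multiplication by `z`. -/
def rZ (q : Set.Ioo (0 : ℝ) 1) : Distr →ₗ[ℂ] Distr where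
  toFun a := fun j k =>
    qc q ^ (2 * k) * lZ a j k + (1 - qc q ^ (2 * (k + 1))) * a j (k + 1)
  map_add' a b := by ext j k; simp; ring
  map_smul' c a := by ext j k; simp; ring

/-- The involution, `(z ^ j z* ^ k)* = z ^ k z* ^ j`, extended antilinearly. -/
def starD (a : Distr) : Distr := fun j k => conj (a k j)

/-! ### The action of `U_q sl₂` on distributions

`Pol(ℂ)_q` is a covariant algebra for the coproduct `Δ(K) = K ⊗ K`, `Δ(E) = E ⊗ 1 + K ⊗ E`,
`Δ(F) = F ⊗ K⁻¹ + 1 ⊗ F`, with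
`K z = q² z`, `E z = -q^(1/2) z²`, `F z = q^(1/2)`,
`K z* = q⁻² z*`, `E z* = q^(-3/2)`, `F z* = -q^(5/2) z*²`. Hence, with `[n]_p = 1 + p + ⋯ + p^(n-1)`,
* `K (z^j z*^k) = q^(2(j-k)) z^j z*^k`,
* `E (z^j z*^k) = -q^(1/2) [j]_{q²} z^(j+1) z*^k + q^(-3/2) q^(2j) [k]_{q⁻²} z^j z*^(k-1)`,
* `F (z^j z*^k) = q^(1/2) q^(2k) [j]_{q⁻²} z^(j-1) z*^k - q^(5/2) [k]_{q²} z^j z*^(k+1)`.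
These are extended to formal series coefficientwise. -/

/-- The `q`-number `1 + p + ⋯ + p ^ (n - 1)`. -/
def qnum (p : ℂ) (n : ℕ) : ℂ := ∑ i ∈ Finset.range n, p ^ i

/-- The action of `K`. -/
def opK (q : Set.Ioo (0 : ℝ) 1) : Distr →ₗ[ℂ] Distr where
  toFun a := fun j k => qc q ^ (2 * j) / qc q ^ (2 * k) * a j k
  map_add' a b := by ext j k; simp; ring
  map_smul' c a := by ext j k; simp; ring

/-- The action of `K⁻¹`. -/
def opK' (q : Set.Ioo (0 : ℝ) 1) : Distr →ₗ[ℂ] Distr where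
  toFun a := fun j k => qc q ^ (2 * k) / qc q ^ (2 * j) * a j k
  map_add' a b := by ext j k; simp; ring
  map_smul' c a := by ext j k; simp; ring

/-- The action of `E`. -/
def opE (q : Set.Ioo (0 : ℝ) 1) : Distr →ₗ[ℂ] Distr where
  toFun a := fun j k =>
    (match j with
      | 0 => 0
      | i + 1 => -qs q * qnum (qc q ^ 2) i * a i k) +
    qs q / qc q ^ 2 * qc q ^ (2 * j) * qnum (qc q ^ 2)⁻¹ (k + 1) * a j (k + 1)
  map_add' a b := by ext j k; cases j <;> simp <;> ring
  map_smul' c a := by ext j k; cases j <;> simp <;> ring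

/-- The action of `F`. -/
def opF (q : Set.Ioo (0 : ℝ) 1) : Distr →ₗ[ℂ] Distr where
  toFun a := fun j k =>
    qs q * qc q ^ (2 * k) * qnum (qc q ^ 2)⁻¹ (j + 1) * a (j + 1) k -
    (match k with
      | 0 => 0
      | i + 1 => qs q * qc q ^ 2 * qnum (qc q ^ 2) i * a j i)
  map_add' a b := by ext j k; cases k <;> simp <;> ring
  map_smul' c a := by ext j k; cases k <;> simp <;> ring

/-- The operator `∂̄`. In the differential calculus on the quantum plane `∂̄ z = 0`,
`dz* z = q² z dz*` and `dz* z* = q⁻² z* dz*`, hence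
`∂̄ (z^j z*^k) = [k]_{q⁻²} z^j z*^(k-1) dz*`. A form `b dz*` is represented by `b`. -/
def dbarD (q : Set.Ioo (0 : ℝ) 1) : Distr →ₗ[ℂ] Distr where
  toFun a := fun j k => qnum (qc q ^ 2)⁻¹ (k + 1) * a j (k + 1)
  map_add' a b := by ext j k; simp; ring
  map_smul' c a := by ext j k; simp; ring

variable (q : Set.Ioo (0 : ℝ) 1)

lemma qc_ne : qc q ≠ 0 := by
  have := q.2.1
  simp only [qc, ne_eq, Complex.ofReal_eq_zero]; linarith

lemma qc_sq_ne_one : qc q ^ 2 ≠ 1 := by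
  have h0 := q.2.1
  have h1 := q.2.2
  intro h
  have : (q : ℝ) ^ 2 = 1 := by exact_mod_cast h
  nlinarith

lemma qs_sq : qs q ^ 2 = qc q := by
  have := q.2.1
  rw [qs, ← Complex.ofReal_pow, Real.sq_sqrt this.le]

lemma qnum_pos (n : ℕ) : qnum (qc q ^ 2) n = (1 - qc q ^ (2 * n)) / (1 - qc q ^ 2) := by
  have := qc_sq_ne_one q
  rw [qnum, geom_sum_eq this, pow_mul, ← neg_div_neg_eq]; simp

lemma qnum_neg (n : ℕ) : qnum (qc q ^ 2)⁻¹ n =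
    (1 - qc q ^ (2 * n)) / (1 - qc q ^ 2) * qc q ^ 2 / qc q ^ (2 * n) := by
  have h := qc_sq_ne_one q
  have h0 := qc_ne q
  have h1 : 1 - qc q ^ 2 ≠ 0 := sub_ne_zero.2 (Ne.symm h)
  have h2 : (qc q ^ 2)⁻¹ ≠ 1 := by simpa using h
  rw [qnum, geom_sum_eq h2, pow_mul]
  have h3 : (qc q ^ 2)⁻¹ - 1 ≠ 0 := sub_ne_zero.2 h2
  rw [div_eq_iff h3, inv_pow]
  field_simp

/-! Covariance of the action and the Leibniz rule for `∂̄`. -/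

lemma lZs_lZ (a : Distr) : lZs q (lZ a) = qc q ^ 2 • lZ (lZs q a) + (1 - qc q ^ 2) • a := by
  ext j k
  rcases j with _ | j <;> rcases k with _ | k <;> simp [lZs, lZ, rZs] <;> ring

lemma opK_lZs (a : Distr) : opK q (lZs q a) = (qc q ^ 2)⁻¹ • lZs q (opK q a) := by
  have h0 := qc_ne q
  ext j k
  rcases k with _ | k <;> simp [lZs, rZs, opK] <;> field_simp <;> ring

lemma opK_rZ (a : Distr) : opK q (rZ q a) = qc q ^ 2 • rZ q (opK q a) := by
  have h0 := qc_ne q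
  ext j k
  rcases j with _ | j <;> simp [rZ, lZ, opK] <;> field_simp <;> ring

lemma opK'_lZs (a : Distr) : opK' q (lZs q a) = qc q ^ 2 • lZs q (opK' q a) := by
  have h0 := qc_ne q
  ext j k
  rcases k with _ | k <;> simp [lZs, rZs, opK'] <;> field_simp <;> ring

lemma opK'_rZ (a : Distr) : opK' q (rZ q a) = (qc q ^ 2)⁻¹ • rZ q (opK' q a) := by
  have h0 := qc_ne q
  ext j k
  rcases j with _ | j <;> simp [rZ, lZ, opK'] <;> field_simp <;> ring

lemma opE_lZ (a : Distr) :
    opE q (lZ a) = -qs q • lZ (lZ a) + qc q ^ 2 • lZ (opE q a) := by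
  have h0 := qc_ne q
  have h1 : 1 - qc q ^ 2 ≠ 0 := sub_ne_zero.2 (Ne.symm (qc_sq_ne_one q))
  ext j k
  rcases j with _ | _ | j <;> simp [lZ, opE, qnum_pos, qnum_neg] <;> field_simp <;> ring

lemma opE_lZs (a : Distr) :
    opE q (lZs q a) = (qs q / qc q ^ 2) • a + (qc q ^ 2)⁻¹ • lZs q (opE q a) := by
  have h0 := qc_ne q
  have h1 : 1 - qc q ^ 2 ≠ 0 := sub_ne_zero.2 (Ne.symm (qc_sq_ne_one q))
  ext j k
  rcases j with _ | j <;> rcases k with _ | k <;>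
    simp [lZs, rZs, opE, qnum_pos, qnum_neg] <;> field_simp <;> ring

lemma opE_rZ (a : Distr) :
    opE q (rZ q a) = rZ q (opE q a) - qs q • rZ q (rZ q (opK q a)) := by
  have h0 := qc_ne q
  have h1 : 1 - qc q ^ 2 ≠ 0 := sub_ne_zero.2 (Ne.symm (qc_sq_ne_one q))
  ext j k
  rcases j with _ | _ | j <;>
    simp [rZ, lZ, opE, opK, qnum_pos, qnum_neg] <;> field_simp <;> ring

lemma opF_lZ (a : Distr) : opF q (lZ a) = qs q • opK' q a + lZ (opF q a) := by
  have h0 := qc_ne q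
  have h1 : 1 - qc q ^ 2 ≠ 0 := sub_ne_zero.2 (Ne.symm (qc_sq_ne_one q))
  ext j k
  rcases j with _ | j <;> rcases k with _ | k <;>
    simp [lZ, opF, opK', qnum_pos, qnum_neg] <;> field_simp <;> ring_nf
  simp

lemma opF_lZs (a : Distr) :
    opF q (lZs q a) = -(qs q * qc q ^ 2) • lZs q (lZs q (opK' q a)) + lZs q (opF q a) := by
  have h0 := qc_ne q
  have h1 : 1 - qc q ^ 2 ≠ 0 := sub_ne_zero.2 (Ne.symm (qc_sq_ne_one q))
  ext j k
  rcases k with _ | _ | k <;>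
    simp [lZs, rZs, opF, opK', qnum_pos, qnum_neg] <;> field_simp <;> ring

lemma opF_rZ (a : Distr) :
    opF q (rZ q a) = (qc q ^ 2)⁻¹ • rZ q (opF q a) + qs q • a := by
  have h0 := qc_ne q
  have h1 : 1 - qc q ^ 2 ≠ 0 := sub_ne_zero.2 (Ne.symm (qc_sq_ne_one q))
  ext j k
  rcases j with _ | j <;> rcases k with _ | k <;>
    simp [rZ, lZ, opF, qnum_pos, qnum_neg] <;> field_simp <;> ring

lemma dbarD_lZ (a : Distr) : dbarD q (lZ a) = lZ (dbarD q a) := by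
  ext j k
  rcases j with _ | j <;> simp [lZ, dbarD]

lemma dbarD_lZs (a : Distr) : dbarD q (lZs q a) = opK q a + lZs q (dbarD q a) := by
  have h0 := qc_ne q
  have h1 : 1 - qc q ^ 2 ≠ 0 := sub_ne_zero.2 (Ne.symm (qc_sq_ne_one q))
  ext j k
  rcases k with _ | k <;>
    simp [lZs, rZs, dbarD, opK, qnum_neg] <;> field_simp <;> ring

lemma dbarD_rZ (a : Distr) : dbarD q (rZ q a) = qc q ^ 2 • rZ q (dbarD q a) := by
  have h0 := qc_ne q
  have h1 : 1 - qc q ^ 2 ≠ 0 := sub_ne_zero.2 (Ne.symm (qc_sq_ne_one q))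
  ext j k
  rcases j with _ | j <;>
    simp [rZ, lZ, dbarD, qnum_neg] <;> field_simp <;> ring

/-- Right multiplication by `y = 1 - z z*`. -/
def rY : Distr →ₗ[ℂ] Distr := LinearMap.id - rZs ∘ₗ rZ q

lemma rY_dbarD (a : Distr) :
    rY q (dbarD q a) = (1 - qc q ^ 2)⁻¹ • (rZ q a - lZ a) := by
  have h0 := qc_ne q
  have h1 : 1 - qc q ^ 2 ≠ 0 := sub_ne_zero.2 (Ne.symm (qc_sq_ne_one q))
  ext j k
  rcases j with _ | j <;> rcases k with _ | k <;>
    simp [rY, rZ, rZs, lZ, dbarD, qnum_neg] <;> field_simp <;> ring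

/-! The operators satisfy the defining relations of `U_q sl₂`. -/

lemma opK_opK' (a : Distr) : opK q (opK' q a) = a := by
  have h0 := qc_ne q
  ext j k; simp [opK, opK']; field_simp

lemma opK'_opK (a : Distr) : opK' q (opK q a) = a := by
  have h0 := qc_ne q
  ext j k; simp [opK, opK']; field_simp

lemma opK_opE (a : Distr) : opK q (opE q a) = qc q ^ 2 • opE q (opK q a) := by
  have h0 := qc_ne q
  ext j k
  rcases j with _ | j <;> simp [opE, opK] <;> field_simp <;> ring

lemma opK'_opE (a : Distr) : opK' q (opE q a) = (qc q ^ 2)⁻¹ • opE q (opK' q a) := by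
  have h0 := qc_ne q
  ext j k
  rcases j with _ | j <;> simp [opE, opK'] <;> field_simp <;> ring

lemma opK_opF (a : Distr) : opK q (opF q a) = (qc q ^ 2)⁻¹ • opF q (opK q a) := by
  have h0 := qc_ne q
  ext j k
  rcases k with _ | k <;> simp [opF, opK] <;> field_simp <;> ring

lemma opK'_opF (a : Distr) : opK' q (opF q a) = qc q ^ 2 • opF q (opK' q a) := by
  have h0 := qc_ne q
  ext j k
  rcases k with _ | k <;> simp [opF, opK'] <;> field_simp <;> ring

lemma opE_opF (a : Distr) : opE q (opF q a) - opF q (opE q a) =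
    (qc q - (qc q)⁻¹)⁻¹ • (opK q a - opK' q a) := by
  have h0 := qc_ne q
  have h1 : 1 - qc q ^ 2 ≠ 0 := sub_ne_zero.2 (Ne.symm (qc_sq_ne_one q))
  have h2 : (qc q - (qc q)⁻¹)⁻¹ = - qc q / (1 - qc q ^ 2) := by
    have : qc q - (qc q)⁻¹ = (1 - qc q ^ 2) / (- qc q) := by field_simp; ring
    rw [this, inv_div]
  have h3 := qs_sq q
  ext j k
  rw [h2]
  rw [← h3] at h0 h1
  have h5 : 1 - qs q ^ 4 ≠ 0 := by rw [← pow_mul] at h1; exact h1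
  have h4 : qs q ≠ 0 := by intro h; simp [h] at h0
  rcases j with _ | j <;> rcases k with _ | k <;>
    simp [opE, opF, opK, opK', qnum_pos, qnum_neg] <;> simp only [← h3] <;> field_simp <;> ring


/-! ### Finite functions -/

/-- An operator which commutes with `A` up to a scalar and a correction preserves the set of
vectors killed by some power of `A`. -/
lemma exists_pow_apply_eq_zero {A X Y : Distr →ₗ[ℂ] Distr} {α : ℂ}
    (h : ∀ a, A (X a) = α • X (A a) + Y a)
    (hY : ∀ a, (∃ N, (A ^ N) a = 0) → ∃ N, (A ^ N) (Y a) = 0)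
    (a : Distr) (ha : ∃ N, (A ^ N) a = 0) : ∃ N, (A ^ N) (X a) = 0 := by
  obtain ⟨N, hN⟩ := ha
  induction N generalizing a with
  | zero =>
    have : a = 0 := by simpa using hN
    exact ⟨0, by simp [this]⟩
  | succ N ih =>
    have h1 : (A ^ N) (A a) = 0 := by rw [← Module.End.mul_apply, ← pow_succ]; exact hN
    obtain ⟨M, hM⟩ := ih (A a) h1
    obtain ⟨M', hM'⟩ := hY a ⟨N + 1, hN⟩
    refine ⟨M + M' + 1, ?_⟩
    rw [pow_succ, Module.End.mul_apply, h, map_add, map_smul]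
    have e1 : (A ^ (M + M')) (X (A a)) = 0 := by
      rw [add_comm, pow_add, Module.End.mul_apply, hM, map_zero]
    have e2 : (A ^ (M + M')) (Y a) = 0 := by
      rw [pow_add, Module.End.mul_apply, hM', map_zero]
    rw [e1, e2, smul_zero, add_zero]

/-- The space `D(U)_q` of finite functions in the quantum disc: the distributions `f` with
`z* ^ N f = f z ^ N = 0` for some `N`. -/
def finiteFunctions : Submodule ℂ Distr where
  carrier := {f | ∃ N : ℕ, (lZs q ^ N) f = 0 ∧ (rZ q ^ N) f = 0}
  add_mem' := by
    rintro a b ⟨N, h1, h2⟩ ⟨M, h3, h4⟩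
    have e1 : (lZs q ^ (N + M)) b = 0 := by
      rw [pow_add, Module.End.mul_apply, h3, map_zero]
    have e2 : (rZ q ^ (N + M)) b = 0 := by
      rw [pow_add, Module.End.mul_apply, h4, map_zero]
    refine ⟨N + M, ?_, ?_⟩
    · rw [map_add, e1, add_comm N M, pow_add, Module.End.mul_apply, h1, map_zero, zero_add]
    · rw [map_add, e2, add_comm N M, pow_add, Module.End.mul_apply, h2, map_zero, zero_add]
  zero_mem' := ⟨0, by simp, by simp⟩
  smul_mem' := by
    rintro c a ⟨N, h1, h2⟩
    exact ⟨N, by rw [map_smul, h1, smul_zero], by rw [map_smul, h2, smul_zero]⟩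

lemma mem_finiteFunctions' {f : Distr} : f ∈ finiteFunctions q ↔
    (∃ N, (lZs q ^ N) f = 0) ∧ ∃ N, (rZ q ^ N) f = 0 := by
  constructor
  · rintro ⟨N, h1, h2⟩
    exact ⟨⟨N, h1⟩, ⟨N, h2⟩⟩
  · rintro ⟨⟨N, h1⟩, ⟨M, h2⟩⟩
    refine ⟨N + M, ?_, ?_⟩
    · rw [add_comm, pow_add, Module.End.mul_apply, h1, map_zero]
    · rw [pow_add, Module.End.mul_apply, h2, map_zero]

lemma mem_finiteFunctions_of {X Y Z : Distr →ₗ[ℂ] Distr} {α β : ℂ}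
    (h1 : ∀ a, lZs q (X a) = α • X (lZs q a) + Y a)
    (h2 : ∀ a, rZ q (X a) = β • X (rZ q a) + Z a)
    (hY : ∀ a, (∃ N, (lZs q ^ N) a = 0) → ∃ N, (lZs q ^ N) (Y a) = 0)
    (hZ : ∀ a, (∃ N, (rZ q ^ N) a = 0) → ∃ N, (rZ q ^ N) (Z a) = 0)
    {f : Distr} (hf : f ∈ finiteFunctions q) : X f ∈ finiteFunctions q := by
  rw [mem_finiteFunctions'] at hf ⊢
  exact ⟨exists_pow_apply_eq_zero h1 hY f hf.1, exists_pow_apply_eq_zero h2 hZ f hf.2⟩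

lemma exists_pow_zero (A : Distr →ₗ[ℂ] Distr) (a : Distr) (_ : ∃ N, (A ^ N) a = 0) :
    ∃ N, (A ^ N) ((0 : Distr →ₗ[ℂ] Distr) a) = 0 := ⟨0, by simp⟩

lemma exists_pow_smul {A X : Distr →ₗ[ℂ] Distr} (c : ℂ) {a : Distr}
    (h : ∃ N, (A ^ N) (X a) = 0) : ∃ N, (A ^ N) ((c • X) a) = 0 := by
  obtain ⟨N, hN⟩ := h
  exact ⟨N, by rw [LinearMap.smul_apply, map_smul, hN, smul_zero]⟩

lemma exists_pow_comp {A X : Distr →ₗ[ℂ] Distr} {a : Distr}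
    (h : ∃ N, (A ^ N) (X a) = 0) : ∃ N, (A ^ N) ((A ∘ₗ X) a) = 0 := by
  obtain ⟨N, hN⟩ := h
  refine ⟨N, ?_⟩
  rw [LinearMap.comp_apply, ← Module.End.mul_apply, ← pow_succ, pow_succ', Module.End.mul_apply,
    hN, map_zero]

lemma lZs_opK (a : Distr) : lZs q (opK q a) = qc q ^ 2 • opK q (lZs q a)
    + (0 : Distr →ₗ[ℂ] Distr) a := by
  have := pow_ne_zero 2 (qc_ne q)
  rw [opK_lZs, smul_smul, mul_inv_cancel₀ this, one_smul]; simp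

lemma rZ_opK (a : Distr) : rZ q (opK q a) = (qc q ^ 2)⁻¹ • opK q (rZ q a)
    + (0 : Distr →ₗ[ℂ] Distr) a := by
  have := pow_ne_zero 2 (qc_ne q)
  rw [opK_rZ, smul_smul, inv_mul_cancel₀ this, one_smul]; simp

lemma lZs_opK' (a : Distr) : lZs q (opK' q a) = (qc q ^ 2)⁻¹ • opK' q (lZs q a)
    + (0 : Distr →ₗ[ℂ] Distr) a := by
  have := pow_ne_zero 2 (qc_ne q)
  rw [opK'_lZs, smul_smul, inv_mul_cancel₀ this, one_smul]; simp

lemma rZ_opK' (a : Distr) : rZ q (opK' q a) = qc q ^ 2 • opK' q (rZ q a)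
    + (0 : Distr →ₗ[ℂ] Distr) a := by
  have := pow_ne_zero 2 (qc_ne q)
  rw [opK'_rZ, smul_smul, mul_inv_cancel₀ this, one_smul]; simp

lemma opK_mem {f : Distr} (hf : f ∈ finiteFunctions q) : opK q f ∈ finiteFunctions q :=
  mem_finiteFunctions_of q (lZs_opK q) (rZ_opK q) (exists_pow_zero _) (exists_pow_zero _) hf

lemma opK'_mem {f : Distr} (hf : f ∈ finiteFunctions q) : opK' q f ∈ finiteFunctions q :=
  mem_finiteFunctions_of q (lZs_opK' q) (rZ_opK' q) (exists_pow_zero _) (exists_pow_zero _) hf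

lemma opE_mem {f : Distr} (hf : f ∈ finiteFunctions q) : opE q f ∈ finiteFunctions q := by
  have h0 := pow_ne_zero 2 (qc_ne q)
  refine mem_finiteFunctions_of q (α := qc q ^ 2) (β := 1)
    (Y := (-qs q) • LinearMap.id) (Z := qs q • (rZ q ∘ₗ (rZ q ∘ₗ opK q)))
    (fun a => ?_) (fun a => ?_) (fun a ha => ?_) (fun a ha => ?_) hf
  · rw [opE_lZs, smul_add, smul_smul, smul_smul, mul_inv_cancel₀ h0, mul_div_cancel₀ _ h0]
    simp
  · rw [opE_rZ]; simp
  · exact exists_pow_smul _ ha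
  · exact exists_pow_smul _ (exists_pow_comp (exists_pow_comp
      (exists_pow_apply_eq_zero (rZ_opK q) (exists_pow_zero _) a ha)))

lemma opF_mem {f : Distr} (hf : f ∈ finiteFunctions q) : opF q f ∈ finiteFunctions q := by
  have h0 := pow_ne_zero 2 (qc_ne q)
  refine mem_finiteFunctions_of q (α := 1) (β := qc q ^ 2)
    (Y := (qs q * qc q ^ 2) • (lZs q ∘ₗ (lZs q ∘ₗ opK' q)))
    (Z := (-(qc q ^ 2 * qs q)) • LinearMap.id)
    (fun a => ?_) (fun a => ?_) (fun a ha => ?_) (fun a ha => ?_) hf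
  · rw [opF_lZs]; simp
  · rw [opF_rZ, smul_add, smul_smul, smul_smul, mul_inv_cancel₀ h0]
    simp
  · exact exists_pow_smul _ (exists_pow_comp (exists_pow_comp
      (exists_pow_apply_eq_zero (lZs_opK' q) (exists_pow_zero _) a ha)))
  · exact exists_pow_smul _ ha

lemma dbarD_mem {f : Distr} (hf : f ∈ finiteFunctions q) : dbarD q f ∈ finiteFunctions q := by
  have h0 := pow_ne_zero 2 (qc_ne q)
  refine mem_finiteFunctions_of q (α := 1) (β := (qc q ^ 2)⁻¹)
    (Y := (-1 : ℂ) • opK q) (Z := 0)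
    (fun a => ?_) (fun a => ?_) (fun a ha => ?_) (exists_pow_zero _) hf
  · rw [dbarD_lZs]; simp
  · rw [dbarD_rZ, smul_smul, inv_mul_cancel₀ h0]; simp
  · exact exists_pow_smul _
      (exists_pow_apply_eq_zero (lZs_opK q) (exists_pow_zero _) a ha)

/-- `D(U)_q` as a type of its own. -/
def FiniteFn : Type := finiteFunctions q

/-- The space `Ω(U)_q^(0,1)` of finite `(0,1)`-forms `f dz*`, `f ∈ D(U)_q`; the form `f dz*` is
represented by `f`. -/
def FiniteForm : Type := finiteFunctions q

instance : AddCommGroup (FiniteFn q) := inferInstanceAs (AddCommGroup (finiteFunctions q))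
instance : Module ℂ (FiniteFn q) := inferInstanceAs (Module ℂ (finiteFunctions q))
instance : AddCommGroup (FiniteForm q) := inferInstanceAs (AddCommGroup (finiteFunctions q))
instance : Module ℂ (FiniteForm q) := inferInstanceAs (Module ℂ (finiteFunctions q))

/-- The distribution underlying a finite function. -/
def FiniteFn.val {q : Set.Ioo (0 : ℝ) 1} (f : FiniteFn q) : Distr :=
  Subtype.val (p := (· ∈ finiteFunctions q)) f

/-- The coefficient `f` of the form `f dz*`. -/
def FiniteForm.coeff {q : Set.Ioo (0 : ℝ) 1} (f : FiniteForm q) : FiniteFn q := f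

lemma FiniteFn.val_mem {q : Set.Ioo (0 : ℝ) 1} (f : FiniteFn q) : f.val ∈ finiteFunctions q :=
  Subtype.prop (p := (· ∈ finiteFunctions q)) f

/-- The action of a generator of `U_q sl₂` on `D(U)_q`. -/
def genAction : Gen → Module.End ℂ (FiniteFn q)
  | .K => (opK q).restrict (fun _ h => opK_mem q h)
  | .K' => (opK' q).restrict (fun _ h => opK'_mem q h)
  | .E => (opE q).restrict (fun _ h => opE_mem q h)
  | .F => (opF q).restrict (fun _ h => opF_mem q h)

/-- The action of `U_q sl₂` on `D(U)_q`. -/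
def uqAction : Uq q →ₐ[ℂ] Module.End ℂ (FiniteFn q) :=
  RingQuot.liftAlgHom ℂ ⟨FreeAlgebra.lift ℂ (genAction q), by
    intro x y h
    induction h <;> refine LinearMap.ext fun f => Subtype.ext ?_ <;>
      simp only [map_mul, map_smul, map_sub, map_one, FreeAlgebra.lift_ι_apply]
    · exact opK_opK' q f.val
    · exact opK'_opK q f.val
    · exact opK_opE q f.val
    · exact opK'_opE q f.val
    · exact opK_opF q f.val
    · exact opK'_opF q f.val
    · exact opE_opF q f.val⟩


/-! ### The matrix realization

`Pol(ℂ)_q` acts in `ℓ²(ℕ)` by `z e_n = (1 - q^(2(n+1)))^(1/2) e_(n+1)`,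
`z* e_n = (1 - q^(2n))^(1/2) e_(n-1)`. Matrix elements of a formal series are finite sums. -/

/-- `(q²; q²)_n = (1 - q²)(1 - q⁴) ⋯ (1 - q^(2n))`. -/
def qPoch (n : ℕ) : ℝ := ∏ i ∈ Finset.range n, (1 - (q : ℝ) ^ (2 * (i + 1)))

lemma one_sub_pow_pos (n : ℕ) : 0 < 1 - (q : ℝ) ^ (2 * (n + 1)) := by
  have := pow_lt_one₀ q.2.1.le q.2.2 (n := 2 * (n + 1)) (by omega)
  linarith

lemma qPoch_pos (n : ℕ) : 0 < qPoch q n :=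
  Finset.prod_pos fun i _ => one_sub_pow_pos q i

lemma qPoch_succ (n : ℕ) : qPoch q (n + 1) = qPoch q n * (1 - (q : ℝ) ^ (2 * (n + 1))) := by
  rw [qPoch, Finset.prod_range_succ]; rfl

/-- The matrix `(l_{mn}(f))` of a distribution `f = ∑ a j k z ^ j z* ^ k` in the basis `e_n`: as
`z ^ j z* ^ k e_n = ((q²;q²)_m (q²;q²)_n)^(1/2) / (q²;q²)_l e_m` for `l = n - k = m - j ≥ 0`,
one sums over `l`. -/
def fock : Distr →ₗ[ℂ] (ℕ → ℕ → ℂ) where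
  toFun a := fun m n => ∑ l ∈ Finset.range (min m n + 1),
    ((Real.sqrt (qPoch q m * qPoch q n) / qPoch q l : ℝ) : ℂ) * a (m - l) (n - l)
  map_add' a b := by ext m n; simp [mul_add, Finset.sum_add_distrib]
  map_smul' c a := by
    ext m n
    simp only [Pi.smul_apply, smul_eq_mul, RingHom.id_apply, Finset.mul_sum]
    exact Finset.sum_congr rfl fun _ _ => by ring

/-- The distribution with a given matrix. -/
def fockInv (M : ℕ → ℕ → ℂ) : Distr := fun j k => ∑ i ∈ Finset.range (min j k + 1),
  (((-1) ^ i * (q : ℝ) ^ (i * (i - 1)) / qPoch q i /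
    Real.sqrt (qPoch q (j - i) * qPoch q (k - i)) : ℝ) : ℂ) * M (j - i) (k - i)

lemma qPoch_partial_sum (n m : ℕ) (h : m ≤ n) :
    ∑ i ∈ Finset.range (m + 1), ((-1) ^ i * (q : ℝ) ^ (i * (i - 1)) / qPoch q i) *
      (1 / qPoch q (n + 1 - i)) = (-1) ^ m * (q : ℝ) ^ (m * (m + 1)) /
        (qPoch q m * qPoch q (n - m) * (1 - (q : ℝ) ^ (2 * (n + 1)))) := by
  induction m with
  | zero =>
    have h0 : qPoch q 0 = 1 := by simp [qPoch]
    simp [qPoch_succ, h0]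
  | succ m ih =>
    rw [Finset.sum_range_succ, ih (by omega)]
    obtain ⟨d, rfl⟩ : ∃ d, n = m + 1 + d := ⟨n - (m + 1), by omega⟩
    have e1 : m + 1 + d - m = d + 1 := by omega
    have e2 : m + 1 + d - (m + 1) = d := by omega
    have e3 : m + 1 + d + 1 - (m + 1) = d + 1 := by omega
    have e4 : m + 1 - 1 = m := by omega
    rw [e1, e2, e3, e4, qPoch_succ, qPoch_succ]
    have h1 := (qPoch_pos q m).ne'
    have h2 := (qPoch_pos q d).ne'
    have h3 := (one_sub_pow_pos q m).ne'
    have h4 := (one_sub_pow_pos q d).ne'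
    have h5 := (one_sub_pow_pos q (m + 1 + d)).ne'
    generalize hx : 1 - (q : ℝ) ^ (2 * (m + 1)) = x at *
    generalize hy : 1 - (q : ℝ) ^ (2 * (d + 1)) = y at *
    generalize hu : 1 - (q : ℝ) ^ (2 * (m + 1 + d + 1)) = u at *
    have key : x - u = - (q : ℝ) ^ (2 * (m + 1)) * y := by
      rw [← hx, ← hy, ← hu]; ring
    have key2 : (q : ℝ) ^ ((m + 1) * (m + 1 + 1)) =
        (q : ℝ) ^ (m * (m + 1)) * (q : ℝ) ^ (2 * (m + 1)) := by rw [← pow_add]; ring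
    have key3 : (m + 1) * m = m * (m + 1) := by ring
    rw [key2, key3, pow_succ]
    field_simp
    linear_combination (q : ℝ) ^ (m * (m + 1)) * key

lemma qPoch_conv (n : ℕ) :
    ∑ i ∈ Finset.range (n + 1), ((-1) ^ i * (q : ℝ) ^ (i * (i - 1)) / qPoch q i) *
      (1 / qPoch q (n - i)) = if n = 0 then 1 else 0 := by
  rcases n with _ | n
  · simp [qPoch]
  · rw [Finset.sum_range_succ, qPoch_partial_sum q n n le_rfl, qPoch_succ]
    have h1 := (qPoch_pos q n).ne'
    have h5 := (one_sub_pow_pos q n).ne'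
    have e4 : n + 1 - 1 = n := by omega
    have e5 : (n + 1) * n = n * (n + 1) := by ring
    rw [e4, e5, pow_succ]
    simp [qPoch]
    field_simp
    ring

lemma conv_inv {a b : PowerSeries ℂ} (hab : a * b = 1) (g : ℕ → ℂ) (t : ℕ) :
    ∑ l ∈ Finset.range (t + 1), a.coeff l * ∑ i ∈ Finset.range (t - l + 1),
      b.coeff i * g (t - l - i) = g t := by
  have h : a * (b * PowerSeries.mk g) = PowerSeries.mk g := by rw [← mul_assoc, hab, one_mul]
  have := congrArg (PowerSeries.coeff t) h
  rw [PowerSeries.coeff_mul, PowerSeries.coeff_mk,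
    Finset.Nat.sum_antidiagonal_eq_sum_range_succ
      (fun x y => a.coeff x * (b * PowerSeries.mk g).coeff y)] at this
  rw [← this]
  refine Finset.sum_congr rfl fun l _ => ?_
  rw [PowerSeries.coeff_mul, Finset.Nat.sum_antidiagonal_eq_sum_range_succ
      (fun x y => b.coeff x * (PowerSeries.mk g).coeff y)]
  simp

lemma series_mul : (PowerSeries.mk fun i => (((-1) ^ i * (q : ℝ) ^ (i * (i - 1)) /
      qPoch q i : ℝ) : ℂ)) * (PowerSeries.mk fun i => ((1 / qPoch q i : ℝ) : ℂ)) = 1 := by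
  ext n
  rw [PowerSeries.coeff_mul, Finset.Nat.sum_antidiagonal_eq_sum_range_succ
      (fun x y => (PowerSeries.mk fun i => (((-1) ^ i * (q : ℝ) ^ (i * (i - 1)) /
      qPoch q i : ℝ) : ℂ)).coeff x * (PowerSeries.mk fun i => ((1 / qPoch q i : ℝ) : ℂ)).coeff y)]
  simp only [PowerSeries.coeff_mk, ← Complex.ofReal_mul, ← Complex.ofReal_sum]
  rw [show Finset.range n.succ = Finset.range (n + 1) from rfl, qPoch_conv, PowerSeries.coeff_one]
  split_ifs <;> simp

lemma sqrt_ne (m n : ℕ) : ((Real.sqrt (qPoch q m * qPoch q n) : ℝ) : ℂ) ≠ 0 := by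
  have := Real.sqrt_pos.2 (mul_pos (qPoch_pos q m) (qPoch_pos q n))
  exact_mod_cast this.ne'

lemma fock_diag (a : Distr) (p r t : ℕ) (h : min p r = 0) :
    fock q a (p + t) (r + t) = ((Real.sqrt (qPoch q (p + t) * qPoch q (r + t)) : ℝ) : ℂ) *
      ∑ l ∈ Finset.range (t + 1), ((1 / qPoch q l : ℝ) : ℂ) * a (p + (t - l)) (r + (t - l)) := by
  have e : min (p + t) (r + t) = t := by omega
  simp only [fock, LinearMap.coe_mk, AddHom.coe_mk, e, Finset.mul_sum]
  refine Finset.sum_congr rfl fun l hl => ?_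
  rw [Finset.mem_range] at hl
  rw [show p + t - l = p + (t - l) by omega, show r + t - l = r + (t - l) by omega]
  push_cast
  ring

lemma fockInv_diag (M : ℕ → ℕ → ℂ) (p r t : ℕ) (h : min p r = 0) :
    fockInv q M (p + t) (r + t) = ∑ i ∈ Finset.range (t + 1),
      (((-1) ^ i * (q : ℝ) ^ (i * (i - 1)) / qPoch q i : ℝ) : ℂ) * (M (p + (t - i)) (r + (t - i)) /
        ((Real.sqrt (qPoch q (p + (t - i)) * qPoch q (r + (t - i))) : ℝ) : ℂ)) := by
  have e : min (p + t) (r + t) = t := by omega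
  simp only [fockInv, e]
  refine Finset.sum_congr rfl fun l hl => ?_
  rw [Finset.mem_range] at hl
  rw [show p + t - l = p + (t - l) by omega, show r + t - l = r + (t - l) by omega]
  push_cast
  ring

lemma exists_diag (m n : ℕ) : ∃ p r t, min p r = 0 ∧ m = p + t ∧ n = r + t :=
  ⟨m - min m n, n - min m n, min m n, by omega, by omega, by omega⟩

lemma fock_fockInv (M : ℕ → ℕ → ℂ) : fock q (fockInv q M) = M := by
  ext m n
  obtain ⟨p, r, t, h, rfl, rfl⟩ := exists_diag m n
  rw [fock_diag q _ p r t h]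
  have := conv_inv ((mul_comm _ _).trans (series_mul q)) (fun s => M (p + s) (r + s) /
    ((Real.sqrt (qPoch q (p + s) * qPoch q (r + s)) : ℝ) : ℂ)) t
  simp only [PowerSeries.coeff_mk] at this
  simp only [fockInv_diag q M p r _ h]
  rw [this, mul_div_cancel₀ _ (sqrt_ne q _ _)]

lemma fockInv_fock (a : Distr) : fockInv q (fock q a) = a := by
  ext m n
  obtain ⟨p, r, t, h, rfl, rfl⟩ := exists_diag m n
  rw [fockInv_diag q _ p r t h]
  have := conv_inv (series_mul q) (fun s => a (p + s) (r + s)) t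
  simp only [PowerSeries.coeff_mk] at this
  simp only [fock_diag q a p r _ h]
  rw [← this]
  refine Finset.sum_congr rfl fun l _ => ?_
  rw [mul_div_cancel_left₀ _ (sqrt_ne q _ _)]

lemma fock_injective : Function.Injective (fock q) :=
  Function.LeftInverse.injective (fockInv_fock q)

/-! The matrices of products with `z` and `z*`. -/

lemma fock_starD (a : Distr) (m n : ℕ) : fock q (starD a) m n = conj (fock q a n m) := by
  simp only [fock, starD, LinearMap.coe_mk, AddHom.coe_mk, map_sum, map_mul, Complex.conj_ofReal]
  rw [min_comm, mul_comm (qPoch q m)]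

lemma starD_rZ (a : Distr) : starD (rZ q a) = lZs q (starD a) := by
  ext j k
  rcases k with _ | k <;> simp [starD, rZ, lZs, lZ, rZs]

lemma starD_lZ (a : Distr) : starD (lZ a) = rZs (starD a) := by
  ext j k
  rcases k with _ | k <;> simp [starD, lZ, rZs]

lemma starD_starD (a : Distr) : starD (starD a) = a := by
  ext j k; simp [starD]

lemma sqrt_qPoch_succ (m n : ℕ) : Real.sqrt (qPoch q (m + 1) * qPoch q n) =
    Real.sqrt (1 - (q : ℝ) ^ (2 * (m + 1))) * Real.sqrt (qPoch q m * qPoch q n) := by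
  rw [← Real.sqrt_mul (one_sub_pow_pos q m).le, qPoch_succ]
  congr 1; ring

lemma fock_lZ_zero (a : Distr) (n : ℕ) : fock q (lZ a) 0 n = 0 := by
  simp [fock, lZ]

lemma fock_lZ_succ (a : Distr) (m n : ℕ) : fock q (lZ a) (m + 1) n =
    ((Real.sqrt (1 - (q : ℝ) ^ (2 * (m + 1))) : ℝ) : ℂ) * fock q a m n := by
  simp only [fock, LinearMap.coe_mk, AddHom.coe_mk, Finset.mul_sum]
  have hs : Finset.range (min m n + 1) ⊆ Finset.range (min (m + 1) n + 1) := by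
    intro x; simp only [Finset.mem_range]; omega
  rw [← Finset.sum_subset hs]
  · refine Finset.sum_congr rfl fun l hl => ?_
    rw [Finset.mem_range] at hl
    rw [show m + 1 - l = m - l + 1 by omega, sqrt_qPoch_succ]
    simp only [lZ, LinearMap.coe_mk, AddHom.coe_mk]
    push_cast; ring
  · intro l h1 h2
    simp only [Finset.mem_range] at h1 h2
    rw [show m + 1 - l = 0 by omega]
    simp [lZ]

lemma fock_rZs_zero (a : Distr) (m : ℕ) : fock q (rZs a) m 0 = 0 := by
  simp [fock, rZs]

lemma fock_rZs_succ (a : Distr) (m n : ℕ) : fock q (rZs a) m (n + 1) =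
    ((Real.sqrt (1 - (q : ℝ) ^ (2 * (n + 1))) : ℝ) : ℂ) * fock q a m n := by
  have h1 := fock_starD q (rZs a) (n + 1) m
  have h2 : starD (rZs a) = lZ (starD a) := by
    rw [← starD_starD (lZ (starD a)), starD_lZ, starD_starD]
  rw [h2, fock_lZ_succ, fock_starD] at h1
  have := congrArg conj h1
  simp only [map_mul, Complex.conj_ofReal, Complex.conj_conj] at this
  exact this.symm

lemma fock_lZs (a : Distr) (m n : ℕ) : fock q (lZs q a) m n =
    ((Real.sqrt (1 - (q : ℝ) ^ (2 * (m + 1))) : ℝ) : ℂ) * fock q a (m + 1) n := by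
  have hq := (one_sub_pow_pos q m).le
  have key : ∑ l ∈ Finset.range (min m n + 1), ((1 / qPoch q l : ℝ) : ℂ) *
      lZs q a (m - l) (n - l) = ((1 - (q : ℝ) ^ (2 * (m + 1)) : ℝ) : ℂ) *
      ∑ l ∈ Finset.range (min (m + 1) n + 1), ((1 / qPoch q l : ℝ) : ℂ) *
        a (m + 1 - l) (n - l) := by
    have e1 : ∑ l ∈ Finset.range (min m n + 1), ((1 / qPoch q l : ℝ) : ℂ) *
        (qc q ^ (2 * (m - l)) * rZs a (m - l) (n - l)) =
        ∑ l ∈ Finset.range (min (m + 1) n + 1),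
          (((q : ℝ) ^ (2 * (m + 1 - l)) * (1 - (q : ℝ) ^ (2 * l)) / qPoch q l : ℝ) : ℂ) *
            a (m + 1 - l) (n - l) := by
      rw [Finset.sum_range_succ' _ (min (m + 1) n)]
      simp only [mul_zero, pow_zero, sub_self, zero_div, Complex.ofReal_zero, zero_mul, add_zero]
      have hs : Finset.range (min (m + 1) n) ⊆ Finset.range (min m n + 1) := by
        intro x; simp only [Finset.mem_range]; omega
      rw [← Finset.sum_subset hs]
      · refine Finset.sum_congr rfl fun l hl => ?_
        rw [Finset.mem_range] at hl
        rw [show n - l = n - (l + 1) + 1 by omega, show m + 1 - (l + 1) = m - l by omega]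
        simp only [rZs, LinearMap.coe_mk, AddHom.coe_mk]
        rw [qPoch_succ]
        have h1 := (qPoch_pos q l).ne'
        have h2 := (one_sub_pow_pos q l).ne'
        rw [mul_div_mul_right _ _ h2]
        push_cast; ring
      · intro l h1 h2
        simp only [Finset.mem_range] at h1 h2
        rw [show n - l = 0 by omega]
        simp [rZs]
    have e2 : ∑ l ∈ Finset.range (min m n + 1), ((1 / qPoch q l : ℝ) : ℂ) *
        ((1 - qc q ^ (2 * (m - l + 1))) * a (m - l + 1) (n - l)) =
        ∑ l ∈ Finset.range (min (m + 1) n + 1),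
          (((1 - (q : ℝ) ^ (2 * (m + 1 - l))) / qPoch q l : ℝ) : ℂ) *
            a (m + 1 - l) (n - l) := by
      have hs : Finset.range (min m n + 1) ⊆ Finset.range (min (m + 1) n + 1) := by
        intro x; simp only [Finset.mem_range]; omega
      rw [← Finset.sum_subset hs]
      · refine Finset.sum_congr rfl fun l hl => ?_
        rw [Finset.mem_range] at hl
        rw [show m + 1 - l = m - l + 1 by omega]
        push_cast; ring
      · intro l h1 h2
        simp only [Finset.mem_range] at h1 h2
        rw [show m + 1 - l = 0 by omega]
        simp
    have e3 : ∀ l, ((1 / qPoch q l : ℝ) : ℂ) * lZs q a (m - l) (n - l) =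
        ((1 / qPoch q l : ℝ) : ℂ) * (qc q ^ (2 * (m - l)) * rZs a (m - l) (n - l)) +
        ((1 / qPoch q l : ℝ) : ℂ) * ((1 - qc q ^ (2 * (m - l + 1))) * a (m - l + 1) (n - l)) :=
      fun l => mul_add _ _ _
    rw [Finset.sum_congr rfl fun l _ => e3 l, Finset.sum_add_distrib, e1, e2, Finset.mul_sum, ← Finset.sum_add_distrib]
    refine Finset.sum_congr rfl fun l hl => ?_
    rw [Finset.mem_range] at hl
    have hp : (q : ℝ) ^ (2 * (m + 1)) = (q : ℝ) ^ (2 * (m + 1 - l)) * (q : ℝ) ^ (2 * l) := by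
      rw [← pow_add]; congr 1; omega
    rw [← add_mul, hp]
    push_cast; ring
  have hL : fock q (lZs q a) m n = ((Real.sqrt (qPoch q m * qPoch q n) : ℝ) : ℂ) *
      ∑ l ∈ Finset.range (min m n + 1), ((1 / qPoch q l : ℝ) : ℂ) * lZs q a (m - l) (n - l) := by
    simp only [fock, LinearMap.coe_mk, AddHom.coe_mk, Finset.mul_sum]
    exact Finset.sum_congr rfl fun l _ => by push_cast; ring
  have hR : fock q a (m + 1) n = ((Real.sqrt (qPoch q (m + 1) * qPoch q n) : ℝ) : ℂ) *
      ∑ l ∈ Finset.range (min (m + 1) n + 1), ((1 / qPoch q l : ℝ) : ℂ) *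
        a (m + 1 - l) (n - l) := by
    simp only [fock, LinearMap.coe_mk, AddHom.coe_mk, Finset.mul_sum]
    exact Finset.sum_congr rfl fun l _ => by push_cast; ring
  rw [hL, hR, key, sqrt_qPoch_succ]
  nth_rw 1 [← Real.mul_self_sqrt hq]
  push_cast; ring

lemma fock_rZ (a : Distr) (m n : ℕ) : fock q (rZ q a) m n =
    ((Real.sqrt (1 - (q : ℝ) ^ (2 * (n + 1))) : ℝ) : ℂ) * fock q a m (n + 1) := by
  have h1 := fock_starD q (rZ q a) n m
  rw [starD_rZ, fock_lZs, fock_starD] at h1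
  have := congrArg conj h1
  simp only [map_mul, Complex.conj_ofReal, Complex.conj_conj] at this
  exact this.symm

lemma fock_rY (a : Distr) (m n : ℕ) :
    fock q (rY q a) m n = ((q : ℝ) ^ (2 * n) : ℝ) * fock q a m n := by
  have : rY q a = a - rZs (rZ q a) := rfl
  rw [this, map_sub, Pi.sub_apply, Pi.sub_apply]
  rcases n with _ | n
  · rw [fock_rZs_zero]; simp
  · have hq := (one_sub_pow_pos q n).le
    rw [fock_rZs_succ, fock_rZ, ← mul_assoc, ← Complex.ofReal_mul, Real.mul_self_sqrt hq]
    push_cast; ring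

/-- `D(U)_q` consists of the distributions whose matrix has finitely many nonzero entries. -/
lemma mem_finiteFunctions {f : Distr} : f ∈ finiteFunctions q ↔
    ∃ N, ∀ m n, N ≤ m ∨ N ≤ n → fock q f m n = 0 := by
  have hne : ∀ n : ℕ, ((Real.sqrt (1 - (q : ℝ) ^ (2 * (n + 1))) : ℝ) : ℂ) ≠ 0 := fun n => by
    exact_mod_cast (Real.sqrt_pos.2 (one_sub_pow_pos q n)).ne'
  have hl : ∀ N, ∀ f : Distr, (lZs q ^ N) f = 0 ↔ ∀ m n, N ≤ m → fock q f m n = 0 := by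
    intro N
    induction N with
    | zero =>
      intro f
      constructor
      · intro h; have : f = 0 := by simpa using h
        simp [this]
      · intro h
        have : f = 0 := fock_injective q (by ext m n; simpa using h m n)
        simp [this]
    | succ N ih =>
      intro f
      rw [pow_succ, Module.End.mul_apply, ih]
      constructor
      · rintro h (_ | m) n hm
        · omega
        · have := h m n (by omega)
          rw [fock_lZs] at this
          exact (mul_eq_zero.1 this).resolve_left (hne m)
      · intro h m n hm
        rw [fock_lZs, h (m + 1) n (by omega), mul_zero]
  have hr : ∀ N, ∀ f : Distr, (rZ q ^ N) f = 0 ↔ ∀ m n, N ≤ n → fock q f m n = 0 := by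
    intro N
    induction N with
    | zero =>
      intro f
      constructor
      · intro h; have : f = 0 := by simpa using h
        simp [this]
      · intro h
        have : f = 0 := fock_injective q (by ext m n; simpa using h m n)
        simp [this]
    | succ N ih =>
      intro f
      rw [pow_succ, Module.End.mul_apply, ih]
      constructor
      · rintro h m (_ | n) hm
        · omega
        · have := h m n (by omega)
          rw [fock_rZ] at this
          exact (mul_eq_zero.1 this).resolve_left (hne n)
      · intro h m n hm
        rw [fock_rZ, h m (n + 1) (by omega), mul_zero]
  constructor
  · rintro ⟨N, h1, h2⟩
    refine ⟨N, fun m n h => ?_⟩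
    rcases h with h | h
    · exact (hl N f).1 h1 m n h
    · exact (hr N f).1 h2 m n h
  · rintro ⟨N, h⟩
    exact ⟨N, (hl N f).2 fun m n hm => h m n (Or.inl hm),
      (hr N f).2 fun m n hn => h m n (Or.inr hn)⟩


/-! ### Product, involution, invariant integral and scalar products -/

/-- The product of finite functions, which corresponds to the product of matrices. -/
def mulFn (f g : FiniteFn q) : FiniteFn q :=
  ⟨fockInv q fun m n => ∑' k, fock q f.val m k * fock q g.val k n, by
    obtain ⟨N, hN⟩ := (mem_finiteFunctions q).1 f.val_mem
    obtain ⟨M, hM⟩ := (mem_finiteFunctions q).1 g.val_mem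
    refine (mem_finiteFunctions q).2 ⟨max N M, fun m n h => ?_⟩
    rw [fock_fockInv]
    rcases h with h | h
    · simp [hN m _ (Or.inl (le_of_max_le_left h))]
    · simp [hM _ n (Or.inr (le_of_max_le_right h))]⟩

/-- The involution of `D(U)_q`. -/
def starFn (f : FiniteFn q) : FiniteFn q :=
  ⟨starD f.val, by
    obtain ⟨N, hN⟩ := (mem_finiteFunctions q).1 f.val_mem
    refine (mem_finiteFunctions q).2 ⟨N, fun m n h => ?_⟩
    rw [fock_starD, hN n m h.symm, map_zero]⟩

/-- Right multiplication of a finite function by `y = 1 - z z*`. -/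
def mulY (f : FiniteFn q) : FiniteFn q :=
  ⟨rY q f.val, by
    obtain ⟨N, hN⟩ := (mem_finiteFunctions q).1 f.val_mem
    refine (mem_finiteFunctions q).2 ⟨N, fun m n h => ?_⟩
    rw [fock_rY, hN m n h, mul_zero]⟩

/-- The invariant integral `∫ f dν = (1 - q²) ∑ ψ₀(q^(2j)) q^(-2j)`, where
`f = ∑_{j>0} z^j ψ_j(y) + ψ₀(y) + ∑_{j>0} ψ_{-j}(y) z*^j`. As `y e_j = q^(2j) e_j`, the value
`ψ₀(q^(2j))` is the diagonal matrix element `l_{jj}(f)`. -/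
def integral (f : FiniteFn q) : ℂ :=
  (1 - qc q ^ 2) * ∑' j : ℕ, fock q f.val j j / qc q ^ (2 * j)

/-- The scalar product `(f₁, f₂) = ∫ f₂* f₁ dν` on `D(U)_q`. -/
def scalar (f₁ f₂ : FiniteFn q) : ℂ := integral q (mulFn q (starFn q f₂) f₁)

/-- The scalar product `(f₁ dz*, f₂ dz*) = ∫ f₂* f₁ dμ`, `dμ = (1 - z z*)² dν`, on
`Ω(U)_q^(0,1)`. -/
def scalarForm (f₁ f₂ : FiniteForm q) : ℂ :=
  integral q (mulY q (mulY q (mulFn q (starFn q f₂.coeff) f₁.coeff)))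

lemma fock_mulFn_star (f g : FiniteFn q) {N : ℕ}
    (hN : ∀ m n, N ≤ m ∨ N ≤ n → fock q g.val m n = 0) (m n : ℕ) :
    fock q (mulFn q (starFn q f) g).val m n =
      ∑ k ∈ Finset.range N, conj (fock q f.val k m) * fock q g.val k n := by
  have h : fock q (mulFn q (starFn q f) g).val m n =
      ∑' k, fock q (starD f.val) m k * fock q g.val k n := by
    change fock q (fockInv q _) m n = _
    rw [fock_fockInv]; rfl
  rw [h, tsum_eq_sum (s := Finset.range N)]
  · exact Finset.sum_congr rfl fun k _ => by rw [fock_starD]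
  · intro k hk
    rw [hN k n (Or.inl (by simpa using hk)), mul_zero]

/-- The weight of the `j`-th column in the scalar product of functions. -/
def weight (j : ℕ) : ℝ := (1 - (q : ℝ) ^ 2) / (q : ℝ) ^ (2 * j)

/-- The weight of the `j`-th column in the scalar product of forms. -/
def weightForm (j : ℕ) : ℝ := (1 - (q : ℝ) ^ 2) * (q : ℝ) ^ (2 * j)

lemma one_sub_sq_pos : 0 < 1 - (q : ℝ) ^ 2 := by simpa using one_sub_pow_pos q 0

lemma weight_pos (j : ℕ) : 0 < weight q j :=
  div_pos (one_sub_sq_pos q) (pow_pos q.2.1 _)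

lemma weightForm_pos (j : ℕ) : 0 < weightForm q j :=
  mul_pos (one_sub_sq_pos q) (pow_pos q.2.1 _)

lemma scalar_eq (f g : FiniteFn q) {N : ℕ}
    (hN : ∀ m n, N ≤ m ∨ N ≤ n → fock q g.val m n = 0) :
    scalar q g f = ∑ j ∈ Finset.range N, ∑ k ∈ Finset.range N,
      (weight q j : ℂ) * (conj (fock q f.val k j) * fock q g.val k j) := by
  rw [scalar, integral, tsum_eq_sum (s := Finset.range N), Finset.mul_sum]
  · refine Finset.sum_congr rfl fun j _ => ?_
    rw [fock_mulFn_star q f g hN, Finset.sum_div, Finset.mul_sum]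
    refine Finset.sum_congr rfl fun k _ => ?_
    simp only [weight]; push_cast; ring
  · intro j hj
    rw [fock_mulFn_star q f g hN]
    simp [hN _ j (Or.inr (by simpa using hj))]

lemma scalarForm_eq (f g : FiniteForm q) {N : ℕ}
    (hN : ∀ m n, N ≤ m ∨ N ≤ n → fock q g.coeff.val m n = 0) :
    scalarForm q g f = ∑ j ∈ Finset.range N, ∑ k ∈ Finset.range N,
      (weightForm q j : ℂ) * (conj (fock q f.coeff.val k j) * fock q g.coeff.val k j) := by
  have hy : ∀ j, fock q (mulY q (mulY q (mulFn q (starFn q f.coeff) g.coeff))).val j j =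
      qc q ^ (2 * j) * (qc q ^ (2 * j) * fock q (mulFn q (starFn q f.coeff) g.coeff).val j j) := by
    intro j
    change fock q (rY q (rY q _)) j j = _
    rw [fock_rY, fock_rY]; push_cast; rfl
  have h0 := qc_ne q
  rw [scalarForm, integral, tsum_eq_sum (s := Finset.range N), Finset.mul_sum]
  · refine Finset.sum_congr rfl fun j _ => ?_
    rw [hy, fock_mulFn_star q f.coeff g.coeff hN, mul_div_cancel_left₀ _ (pow_ne_zero _ h0), Finset.mul_sum,
      Finset.mul_sum]
    refine Finset.sum_congr rfl fun k _ => ?_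
    simp only [weightForm]; push_cast; ring
  · intro j hj
    rw [hy, fock_mulFn_star q f.coeff g.coeff hN]
    simp [hN _ j (Or.inr (by simpa using hj))]

/-- The inclusion of finite functions in distributions. -/
def valFn : FiniteFn q →ₗ[ℂ] Distr := (finiteFunctions q).subtype

/-- The coefficients of finite forms as distributions. -/
def valForm : FiniteForm q →ₗ[ℂ] Distr := (finiteFunctions q).subtype

lemma exists_bound {a b : Distr} (ha : a ∈ finiteFunctions q) (hb : b ∈ finiteFunctions q) :
    ∃ N, (∀ m n, N ≤ m ∨ N ≤ n → fock q a m n = 0) ∧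
      (∀ m n, N ≤ m ∨ N ≤ n → fock q b m n = 0) := by
  obtain ⟨N, hN⟩ := (mem_finiteFunctions q).1 ha
  obtain ⟨M, hM⟩ := (mem_finiteFunctions q).1 hb
  exact ⟨max N M, fun m n h => hN m n (h.imp le_of_max_le_left le_of_max_le_left),
    fun m n h => hM m n (h.imp le_of_max_le_right le_of_max_le_right)⟩

/-- A weighted Hilbert-Schmidt scalar product is positive definite. -/
@[reducible] def coreOf {V : Type} [AddCommGroup V] [Module ℂ V] (v : V →ₗ[ℂ] Distr)
    (hv : Function.Injective v) (hmem : ∀ x, v x ∈ finiteFunctions q)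
    (c : ℕ → ℝ) (hc : ∀ j, 0 < c j) (B : V → V → ℂ)
    (hB : ∀ (f g : V) (N : ℕ), (∀ m n, N ≤ m ∨ N ≤ n → fock q (v g) m n = 0) →
      B f g = ∑ j ∈ Finset.range N, ∑ k ∈ Finset.range N,
        (c j : ℂ) * (conj (fock q (v f) k j) * fock q (v g) k j)) :
    InnerProductSpace.Core ℂ V where
  inner := B
  conj_inner_symm f g := by
    obtain ⟨N, h1, h2⟩ := exists_bound q (hmem f) (hmem g)
    rw [hB _ _ N h1, hB _ _ N h2]
    simp only [map_sum, map_mul, Complex.conj_ofReal, Complex.conj_conj]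
    exact Finset.sum_congr rfl fun j _ => Finset.sum_congr rfl fun k _ => by ring
  re_inner_nonneg f := by
    obtain ⟨N, h1, -⟩ := exists_bound q (hmem f) (hmem f)
    rw [hB _ _ N h1]
    simp only [← Complex.normSq_eq_conj_mul_self, ← Complex.ofReal_mul, ← Complex.ofReal_sum]
    rw [RCLike.re_to_complex, Complex.ofReal_re]
    exact Finset.sum_nonneg fun j _ => Finset.sum_nonneg fun k _ =>
      mul_nonneg (hc j).le (Complex.normSq_nonneg _)
  add_left f g h := by
    obtain ⟨N, h1, -⟩ := exists_bound q (hmem h) (hmem h)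
    rw [hB _ _ N h1, hB _ _ N h1, hB _ _ N h1]
    simp only [map_add, Pi.add_apply, add_mul, mul_add, Finset.sum_add_distrib]
  smul_left f g a := by
    obtain ⟨N, h1, -⟩ := exists_bound q (hmem g) (hmem g)
    rw [hB _ _ N h1, hB _ _ N h1]
    simp only [map_smul, Pi.smul_apply, smul_eq_mul, map_mul, Finset.mul_sum]
    exact Finset.sum_congr rfl fun j _ => Finset.sum_congr rfl fun k _ => by ring
  definite f hf := by
    obtain ⟨N, h1, -⟩ := exists_bound q (hmem f) (hmem f)
    rw [hB _ _ N h1] at hf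
    simp only [← Complex.normSq_eq_conj_mul_self, ← Complex.ofReal_mul, ← Complex.ofReal_sum,
      Complex.ofReal_eq_zero] at hf
    have hn : ∀ j k, 0 ≤ c j * Complex.normSq (fock q (v f) k j) := fun j k =>
      mul_nonneg (hc j).le (Complex.normSq_nonneg _)
    rw [Finset.sum_eq_zero_iff_of_nonneg fun j _ => Finset.sum_nonneg fun k _ => hn j k] at hf
    refine hv (fock_injective q ?_)
    ext m n
    rw [map_zero, map_zero]
    by_cases h : N ≤ m ∨ N ≤ n
    · exact h1 m n h
    · push Not at h
      have := (Finset.sum_eq_zero_iff_of_nonneg fun k _ => hn n k).1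
        (hf n (Finset.mem_range.2 h.2)) m (Finset.mem_range.2 h.1)
      exact Complex.normSq_eq_zero.1 ((mul_eq_zero.1 this).resolve_left (hc n).ne')

/-- The scalar product of `D(U)_q`. Mathlib's inner products are antilinear in the first
variable, hence `inner f g = (g, f)`. -/
@[reducible] def coreFn : InnerProductSpace.Core ℂ (FiniteFn q) :=
  coreOf q (valFn q) Subtype.val_injective FiniteFn.val_mem (weight q) (weight_pos q)
    (fun f g => scalar q g f) fun f g _ hN => scalar_eq q f g hN

/-- The scalar product of `Ω(U)_q^(0,1)`, with `inner f g = (g, f)`. -/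
@[reducible] def coreForm : InnerProductSpace.Core ℂ (FiniteForm q) :=
  coreOf q (valForm q) Subtype.val_injective (fun x => x.coeff.val_mem) (weightForm q)
    (weightForm_pos q) (fun f g => scalarForm q g f) fun f g _ hN => scalarForm_eq q f g hN

instance : NormedAddCommGroup (FiniteFn q) := (coreFn q).toNormedAddCommGroup
instance : InnerProductSpace ℂ (FiniteFn q) := InnerProductSpace.ofCore (coreFn q).toCore
instance : NormedAddCommGroup (FiniteForm q) := (coreForm q).toNormedAddCommGroup
instance : InnerProductSpace ℂ (FiniteForm q) := InnerProductSpace.ofCore (coreForm q).toCore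

/-- The Hilbert space `L²(dν)_q`, the completion of `D(U)_q`. -/
abbrev L2nu : Type := UniformSpace.Completion (FiniteFn q)

/-- The Hilbert space `L²(dμ)_q`, the completion of `Ω(U)_q^(0,1)`. -/
abbrev L2mu : Type := UniformSpace.Completion (FiniteForm q)

/-! ### The operators `∂̄` and `□` -/

/-- The operator `∂̄ : D(U)_q → Ω(U)_q^(0,1)`. -/
def dbar : FiniteFn q →ₗ[ℂ] FiniteForm q := (dbarD q).restrict (fun _ h => dbarD_mem q h)

lemma inner_fn (f g : FiniteFn q) : inner ℂ f g = scalar q g f := rfl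

lemma inner_form (f g : FiniteForm q) : inner ℂ f g = scalarForm q g f := rfl

lemma norm_sq_fn (f : FiniteFn q) {N : ℕ}
    (hN : ∀ m n, N ≤ m ∨ N ≤ n → fock q f.val m n = 0) :
    ‖f‖ ^ 2 = ∑ j ∈ Finset.range N, ∑ k ∈ Finset.range N,
      weight q j * Complex.normSq (fock q f.val k j) := by
  rw [@norm_sq_eq_re_inner ℂ, inner_fn, scalar_eq q f f hN]
  simp only [← Complex.normSq_eq_conj_mul_self, ← Complex.ofReal_mul, ← Complex.ofReal_sum]
  exact RCLike.ofReal_re _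

lemma norm_sq_form (f : FiniteForm q) {N : ℕ}
    (hN : ∀ m n, N ≤ m ∨ N ≤ n → fock q f.coeff.val m n = 0) :
    ‖f‖ ^ 2 = ∑ j ∈ Finset.range N, ∑ k ∈ Finset.range N,
      weightForm q j * Complex.normSq (fock q f.coeff.val k j) := by
  rw [@norm_sq_eq_re_inner ℂ, inner_form, scalarForm_eq q f f hN]
  simp only [← Complex.normSq_eq_conj_mul_self, ← Complex.ofReal_mul, ← Complex.ofReal_sum]
  exact RCLike.ofReal_re _

lemma normSq_sub_le (a b : ℂ) :
    Complex.normSq (a - b) ≤ 2 * Complex.normSq a + 2 * Complex.normSq b := by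
  simp only [Complex.normSq_apply, Complex.sub_re, Complex.sub_im]
  nlinarith [sq_nonneg (a.re + b.re), sq_nonneg (a.im + b.im)]

lemma normSq_sqrt_mul_le (n : ℕ) (a : ℂ) :
    Complex.normSq (((Real.sqrt (1 - (q : ℝ) ^ (2 * (n + 1))) : ℝ) : ℂ) * a) ≤
      Complex.normSq a := by
  rw [map_mul, Complex.normSq_ofReal, Real.mul_self_sqrt (one_sub_pow_pos q n).le]
  have := pow_pos q.2.1 (2 * (n + 1))
  nlinarith [Complex.normSq_nonneg a]

lemma norm_sq_dbar_le (f : FiniteFn q) :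
    ‖dbar q f‖ ^ 2 ≤ (2 / (1 - (q : ℝ) ^ 2)) ^ 2 * ‖f‖ ^ 2 := by
  obtain ⟨N, hf, hg⟩ := exists_bound q f.val_mem (dbar q f).coeff.val_mem
  have hf' : ∀ m n, N + 1 ≤ m ∨ N + 1 ≤ n → fock q f.val m n = 0 := fun m n h =>
    hf m n (h.imp (fun h => by omega) (fun h => by omega))
  have hp := one_sub_sq_pos q
  set C : ℝ := (1 - (q : ℝ) ^ 2)⁻¹ with hC
  rw [norm_sq_form q _ hg]
  set F : ℕ → ℕ → ℝ := fun j k => weight q j * Complex.normSq (fock q f.val k j) with hF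
  have hF0 : ∀ j k, 0 ≤ F j k := fun j k =>
    mul_nonneg (weight_pos q j).le (Complex.normSq_nonneg _)
  have hnorm : ‖f‖ ^ 2 = ∑ j ∈ Finset.range (N + 1), ∑ k ∈ Finset.range (N + 1), F j k :=
    norm_sq_fn q f hf'
  let G : ℕ → ℕ → ℝ := fun j k => match k with
    | 0 => 0
    | i + 1 => F j i
  have hpt : ∀ j k, weightForm q j * Complex.normSq (fock q (dbar q f).coeff.val k j) ≤
      C ^ 2 * (2 * F (j + 1) k + 2 * G j k) := by
    intro j k
    have h1 : ((q : ℝ) ^ (2 * j) : ℝ) * fock q (dbar q f).coeff.val k j =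
        (C : ℂ) * (fock q (rZ q f.val) k j - fock q (lZ f.val) k j) := by
      rw [← fock_rY]
      change fock q (rY q (dbarD q f.val)) k j = _
      rw [rY_dbarD, map_smul, map_sub]
      simp [hC]
    have h2 : weightForm q j * Complex.normSq (fock q (dbar q f).coeff.val k j) =
        weight q j * Complex.normSq (((q : ℝ) ^ (2 * j) : ℝ) * fock q (dbar q f).coeff.val k j) := by
      have := (pow_pos q.2.1 (2 * j)).ne'
      rw [map_mul, Complex.normSq_ofReal, weight, weightForm]
      field_simp
    rw [h2, h1, map_mul, Complex.normSq_ofReal]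
    have h3 := normSq_sub_le (fock q (rZ q f.val) k j) (fock q (lZ f.val) k j)
    have h4 : weight q j * Complex.normSq (fock q (rZ q f.val) k j) ≤ F (j + 1) k := by
      rw [fock_rZ]
      refine mul_le_mul ?_ (normSq_sqrt_mul_le q j _) (Complex.normSq_nonneg _)
        (weight_pos q _).le
      exact div_le_div_of_nonneg_left hp.le (pow_pos q.2.1 _)
        (pow_le_pow_of_le_one q.2.1.le q.2.2.le (by omega))
    have h5 : weight q j * Complex.normSq (fock q (lZ f.val) k j) ≤ G j k := by
      rcases k with _ | k
      · rw [fock_lZ_zero]; simp [G]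
      · rw [fock_lZ_succ]
        exact mul_le_mul_of_nonneg_left (normSq_sqrt_mul_le q k _) (weight_pos q j).le
    have h6 := mul_le_mul_of_nonneg_left h3 (weight_pos q j).le
    have h7 : weight q j * Complex.normSq (fock q (rZ q f.val) k j - fock q (lZ f.val) k j) ≤
        2 * F (j + 1) k + 2 * G j k := by linarith
    have := mul_le_mul_of_nonneg_left h7 (sq_nonneg C)
    linarith
  have hs1 : ∑ j ∈ Finset.range N, ∑ k ∈ Finset.range N, F (j + 1) k ≤ ‖f‖ ^ 2 := by
    rw [hnorm, Finset.sum_range_succ' (fun j => ∑ k ∈ Finset.range (N + 1), F j k)]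
    have h0 : 0 ≤ ∑ k ∈ Finset.range (N + 1), F 0 k := Finset.sum_nonneg fun k _ => hF0 0 k
    have : ∑ j ∈ Finset.range N, ∑ k ∈ Finset.range N, F (j + 1) k ≤
        ∑ j ∈ Finset.range N, ∑ k ∈ Finset.range (N + 1), F (j + 1) k := by
      refine Finset.sum_le_sum fun j _ => ?_
      rw [Finset.sum_range_succ _ N]
      linarith [hF0 (j + 1) N]
    linarith
  have hs2 : ∑ j ∈ Finset.range N, ∑ k ∈ Finset.range N, G j k ≤ ‖f‖ ^ 2 := by
    rw [hnorm, Finset.sum_range_succ _ N]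
    have h0 : 0 ≤ ∑ k ∈ Finset.range (N + 1), F N k := Finset.sum_nonneg fun k _ => hF0 N k
    have : ∑ j ∈ Finset.range N, ∑ k ∈ Finset.range N, G j k ≤
        ∑ j ∈ Finset.range N, ∑ k ∈ Finset.range (N + 1), F j k := by
      refine Finset.sum_le_sum fun j _ => ?_
      rcases N with _ | N
      · simp [hF0 j 0]
      · rw [Finset.sum_range_succ' (G j), Finset.sum_range_succ, Finset.sum_range_succ]
        have e : ∑ k ∈ Finset.range N, G j (k + 1) = ∑ k ∈ Finset.range N, F j k := rfl
        have e' : G j 0 = 0 := rfl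
        rw [e, e']
        linarith [hF0 j N, hF0 j (N + 1)]
    linarith
  calc _ ≤ ∑ j ∈ Finset.range N, ∑ k ∈ Finset.range N,
        C ^ 2 * (2 * F (j + 1) k + 2 * G j k) :=
        Finset.sum_le_sum fun j _ => Finset.sum_le_sum fun k _ => hpt j k
    _ = C ^ 2 * (2 * (∑ j ∈ Finset.range N, ∑ k ∈ Finset.range N, F (j + 1) k) +
        2 * ∑ j ∈ Finset.range N, ∑ k ∈ Finset.range N, G j k) := by
        simp only [← Finset.mul_sum, Finset.sum_add_distrib]
    _ ≤ C ^ 2 * (2 * ‖f‖ ^ 2 + 2 * ‖f‖ ^ 2) := by gcongr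
    _ = _ := by rw [hC]; ring

lemma norm_dbar_le (f : FiniteFn q) : ‖dbar q f‖ ≤ 2 / (1 - (q : ℝ) ^ 2) * ‖f‖ := by
  have h := norm_sq_dbar_le q f
  rw [← mul_pow] at h
  exact le_of_sq_le_sq h (mul_nonneg (div_nonneg zero_le_two (one_sub_sq_pos q).le)
    (norm_nonneg f))

/-- The bounded operator `∂̄ : L²(dν)_q → L²(dμ)_q`, the extension of `∂̄` from `D(U)_q` by
continuity. -/
def dbarL2 : L2nu q →L[ℂ] L2mu q :=
  ((dbar q).mkContinuous _ (norm_dbar_le q)).completion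

/-- The Laplace-Beltrami operator `□ = -∂̄* ∂̄` in `L²(dν)_q`. -/
def box : L2nu q →L[ℂ] L2nu q :=
  -((ContinuousLinearMap.adjoint (dbarL2 q)).comp (dbarL2 q))

end QuantumDisc

end

open scoped ComplexConjugate

namespace QuantumDisc

variable (q : Set.Ioo (0 : ℝ) 1)

/-! The key is that `∂̄` is, up to a column rescaling, a commutator with `z`: by `rY_dbarD`, if `∂̄
f = b dz*` then `b y = (1 - q²)⁻¹ (f z - z f)` with `y = 1 - z z*`. On matrices, right
multiplication by `y` multiplies column `j` by `q^(2j)`, and the measure `dμ = y² dν` carries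
exactly the weight needed to absorb two such factors. Hence `(∂̄ f, ∂̄ g) = (1 - q²)⁻² (f z - z f, g
z - z g)`, where the right side is a scalar product in `L²(dν)_q` and the differential calculus has
disappeared.

Let `L` and `R` denote left and right multiplications. In `L²(dν)_q` the adjoint of `L(z)` is
`L(z*)`, while the adjoint of `R(z)` is `q² R(z*)`, because the column weights of `dν` are not
constant (`sum_conj_lZ`, `sum_conj_rZ`). So `∂̄* ∂̄` acts on finite functions as `(1 - q²)⁻² (q²
R(z*) - L(z*)) (R(z) - L(z))`. A coefficient computation on formal series shows that `Ω` is `-q`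
times this same operator (`casimir_distr`).

The two facts combine in `inner_casimir`, which identifies the form of `Ω` on finite functions with
`-q` times the form `(∂̄ f, ∂̄ g)`. Since finite functions are dense, testing `q □ f` and `Ω f`
against them gives equality in the completion. -/

/-! ### The Casimir element as a second-order expression in multiplications by `z` and `z*`. -/

/-- On distributions, the Casimir element acts as a multiple of `(q² R(z*) - L(z*)) (R(z) - L(z))`,
where `L` and `R` are the left and right multiplications. -/
lemma casimir_distr (a : Distr) :
    opF q (opE q a) + (((qc q)⁻¹ - qc q) ^ 2)⁻¹ •
      ((qc q)⁻¹ • opK' q a + qc q • opK q a - ((qc q)⁻¹ + qc q) • a) =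
    -(qc q * ((1 - qc q ^ 2)⁻¹ * (1 - qc q ^ 2)⁻¹)) •
      (qc q ^ 2 • rZs (rZ q a - lZ a) - lZs q (rZ q a - lZ a)) := by
  have h0 := qc_ne q
  have h1 : 1 - qc q ^ 2 ≠ 0 := sub_ne_zero.2 (Ne.symm (qc_sq_ne_one q))
  have h2 : (((qc q)⁻¹ - qc q) ^ 2)⁻¹ = qc q ^ 2 / (1 - qc q ^ 2) ^ 2 := by
    have : (qc q)⁻¹ - qc q = (1 - qc q ^ 2) / qc q := by field_simp
    rw [this, div_pow, inv_div]
  have h3 := qs_sq q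
  -- A coefficient of either side involves only finitely many neighbouring coefficients of `a`, so
  -- the identity needs no finiteness of `a` and reduces to identities between rational functions of
  -- `q^(1/2)`.
  ext j k
  rw [h2]
  -- `E` and `F` carry factors `q^(1/2)`. Writing `q` as `qs q ^ 2` throughout leaves a single
  -- variable for `field_simp` and `ring`; the nonvanishing facts are restated in it.
  rw [← h3] at h0 h1
  have h5 : 1 - qs q ^ 4 ≠ 0 := by rw [← pow_mul] at h1; exact h1
  have h4 : qs q ≠ 0 := by intro h; simp [h] at h0
  -- The boundary cases `j = 0` and `k = 0` are separate because the shifts raising a degree are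
  -- defined by cases, with value `0` there.
  rcases j with _ | j <;> rcases k with _ | k <;>
    simp [opE, opF, opK, opK', rZ, lZ, rZs, lZs, qnum_pos, qnum_neg] <;> simp only [← h3] <;>
    field_simp <;> ring

/-- The action is an algebra homomorphism given on generators by restrictions of the operators on
distributions, so the formula for formal series passes to `D(U)_q`. -/
lemma val_casimir (f : FiniteFn q) : (uqAction q (casimir q) f).val =
    -(qc q * ((1 - qc q ^ 2)⁻¹ * (1 - qc q ^ 2)⁻¹)) •
      (qc q ^ 2 • rZs (rZ q f.val - lZ f.val) - lZs q (rZ q f.val - lZ f.val)) := by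
  have hg : ∀ g, uqAction q (gen q g) = genAction q g := fun g => by
    rw [uqAction, gen, RingQuot.liftAlgHom_mkAlgHom_apply, FreeAlgebra.lift_ι_apply]
  rw [← casimir_distr]
  simp only [casimir, map_add, map_sub, map_mul, map_smul, map_one, hg]
  rfl

/-- This is `rY_dbarD` read on matrices, where right multiplication by `y` is diagonal with entry
`q^(2n)` in column `n`. It trades `∂̄ f` for the commutator of `f` with `z`, and shows that the two
matrices have the same support. -/
lemma fock_rZ_sub_lZ (f : FiniteFn q) (m n : ℕ) :
    fock q (rZ q f.val - lZ f.val) m n =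
      (1 - qc q ^ 2) * (qc q ^ (2 * n) * fock q (dbar q f).coeff.val m n) := by
  have h1 : 1 - qc q ^ 2 ≠ 0 := sub_ne_zero.2 (Ne.symm (qc_sq_ne_one q))
  have h : rZ q f.val - lZ f.val = (1 - qc q ^ 2) • rY q (dbar q f).coeff.val := by
    change _ = (1 - qc q ^ 2) • rY q (dbarD q f.val)
    rw [rY_dbarD, smul_smul, mul_inv_cancel₀ h1, one_smul]
  rw [h, map_smul, Pi.smul_apply, Pi.smul_apply, fock_rY, smul_eq_mul]
  push_cast; rfl

/-! ### Adjoints of the multiplications by `z` in `L²(dν)_q`. -/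

/-- This measures how far the invariant integral is from a trace. It is the only source of the
factor `q²` in the adjoint of right multiplication by `z`, which shifts columns; left multiplication
shifts rows, on which the weight does not depend. -/
lemma weight_eq (j : ℕ) : (weight q j : ℂ) = qc q ^ 2 * weight q (j + 1) := by
  have h0 := qc_ne q
  simp only [weight]
  push_cast
  rw [mul_add, mul_one, pow_add]
  field_simp

/-- In the scalar product of `L²(dν)_q`, right multiplication by `z` is adjoint to `q²` times
right multiplication by `z*`. -/
lemma sum_conj_rZ (g h : Distr) {N : ℕ} (hN : ∀ m n, N ≤ m ∨ N ≤ n → fock q h m n = 0) :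
    ∑ j ∈ Finset.range (N + 1), ∑ k ∈ Finset.range (N + 1),
      (weight q j : ℂ) * (conj (fock q (rZ q g) k j) * fock q h k j) =
    ∑ j ∈ Finset.range (N + 1), ∑ k ∈ Finset.range (N + 1),
      (weight q j : ℂ) * (conj (fock q g k j) * (qc q ^ 2 * fock q (rZs h) k j)) := by
  -- The last column is split off on the left and column `0` on the right. The remaining columns
  -- match under `j ↦ j + 1`; column `N` of `h` is zero, and so is column `0` of `h z*`.
  rw [Finset.sum_range_succ]
  conv_rhs => rw [Finset.sum_range_succ']
  congr 1
  · refine Finset.sum_congr rfl fun j _ => Finset.sum_congr rfl fun k _ => ?_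
    rw [fock_rZ, fock_rZs_succ, weight_eq, map_mul, Complex.conj_ofReal]
    ring
  · simp [hN _ N (Or.inr le_rfl), fock_rZs_zero]

/-- In the scalar product of `L²(dν)_q`, left multiplication by `z` is adjoint to left
multiplication by `z*`. -/
lemma sum_conj_lZ (g h : Distr) {N : ℕ} (hN : ∀ m n, N ≤ m ∨ N ≤ n → fock q h m n = 0) :
    ∑ j ∈ Finset.range (N + 1), ∑ k ∈ Finset.range (N + 1),
      (weight q j : ℂ) * (conj (fock q (lZ g) k j) * fock q h k j) =
    ∑ j ∈ Finset.range (N + 1), ∑ k ∈ Finset.range (N + 1),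
      (weight q j : ℂ) * (conj (fock q g k j) * fock q (lZs q h) k j) := by
  refine Finset.sum_congr rfl fun j _ => ?_
  -- The same shift, now in the rows: row `0` of `z g` is zero, and row `N` of `z* h` is a multiple
  -- of row `N + 1` of `h`, which is zero.
  rw [Finset.sum_range_succ', Finset.sum_range_succ _ N]
  congr 1
  · refine Finset.sum_congr rfl fun k _ => ?_
    rw [fock_lZ_succ, fock_lZs, map_mul, Complex.conj_ofReal]
    ring
  · simp [fock_lZ_zero, fock_lZs, hN (N + 1) j (Or.inl (Nat.le_succ N))]

/-! ### The sesquilinear form of the Casimir element and its extension to the completion. -/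

/-- The Casimir element is represented by the sesquilinear form `-q (∂̄ f, ∂̄ g)`. -/
lemma inner_casimir (f g : FiniteFn q) :
    inner ℂ g (uqAction q (casimir q) f) = -qc q * inner ℂ (dbar q g) (dbar q f) := by
  have h1 : 1 - qc q ^ 2 ≠ 0 := sub_ne_zero.2 (Ne.symm (qc_sq_ne_one q))
  have h0 := qc_ne q
  obtain ⟨N, hc, hd⟩ := exists_bound q (uqAction q (casimir q) f).val_mem
    (dbar q f).coeff.val_mem
  -- The sums run over `N + 1` indices although the supports fit in `N`: the extra row and column
  -- leave room for the shifts by `z*`.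
  have hN : ∀ m n, N + 1 ≤ m ∨ N + 1 ≤ n → N ≤ m ∨ N ≤ n := fun m n h => by omega
  have hh : ∀ m n, N ≤ m ∨ N ≤ n → fock q (rZ q f.val - lZ f.val) m n = 0 := fun m n h => by
    rw [fock_rZ_sub_lZ, hd m n h, mul_zero, mul_zero]
  rw [inner_fn, inner_form, scalar_eq q _ _ fun m n h => hc m n (hN m n h),
    scalarForm_eq q _ _ fun m n h => hd m n (hN m n h), val_casimir]
  -- As `weightForm q j = q^(4j) * weight q j`, the two column factors `q^(2j)` from
  -- `fock_rZ_sub_lZ` are absorbed and only `(1 - q²)⁻²` remains. The commutator of `g` is split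
  -- into two terms, while that of `f` stays whole, to serve as the `h` of the adjointness lemmas.
  have hform : ∀ j k, (weightForm q j : ℂ) *
      (conj (fock q (dbar q g).coeff.val k j) * fock q (dbar q f).coeff.val k j) =
      ((1 - qc q ^ 2)⁻¹ * (1 - qc q ^ 2)⁻¹) * ((weight q j : ℂ) *
        (conj (fock q (rZ q g.val) k j) * fock q (rZ q f.val - lZ f.val) k j) -
        (weight q j : ℂ) *
        (conj (fock q (lZ g.val) k j) * fock q (rZ q f.val - lZ f.val) k j)) := by
    intro j k
    have e : fock q (rZ q g.val) k j - fock q (lZ g.val) k j =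
        (1 - qc q ^ 2) * (qc q ^ (2 * j) * fock q (dbar q g).coeff.val k j) := by
      rw [← fock_rZ_sub_lZ, map_sub]; rfl
    rw [← mul_sub, ← sub_mul, ← map_sub, e, fock_rZ_sub_lZ]
    simp only [weight, weightForm, map_mul, map_sub, map_pow, map_one, Complex.conj_ofReal]
    push_cast
    field_simp
  simp only [hform]
  -- The constant leaves both sums so that what remains has the shape of the left sides of
  -- `sum_conj_rZ` and `sum_conj_lZ`.
  simp_rw [← Finset.mul_sum (Finset.range (N + 1)) _ ((1 - qc q ^ 2)⁻¹ * (1 - qc q ^ 2)⁻¹)]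
  simp only [Finset.sum_sub_distrib]
  rw [sum_conj_rZ q _ _ hh, sum_conj_lZ q _ _ hh]
  -- With both multiplications moved to the other factor, the sides agree entry by entry: the
  -- operator now applied to the commutator of `f` is the one in `val_casimir`.
  simp only [← Finset.sum_sub_distrib, Finset.mul_sum, map_smul, map_sub (fock q), Pi.smul_apply,
    Pi.sub_apply, smul_eq_mul]
  refine Finset.sum_congr rfl fun j _ => Finset.sum_congr rfl fun k _ => ?_
  ring

lemma dbarL2_coe (f : FiniteFn q) : dbarL2 q (f : L2nu q) = (dbar q f : L2mu q) :=
  ContinuousLinearMap.completion_apply_coe _ _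

end QuantumDisc

/-- For every finite function `f` in the quantum disc, `q □ f = Ω f`, where `□ = -∂̄* ∂̄` is the
Laplace-Beltrami operator and `Ω` is the quantum Casimir element. -/
theorem proposition5p2 (q : Set.Ioo (0 : ℝ) 1) (f : QuantumDisc.FiniteFn q) :
    ((q : ℝ) : ℂ) • QuantumDisc.box q (f : QuantumDisc.L2nu q) =
      ((QuantumDisc.uqAction q (QuantumDisc.casimir q) f : QuantumDisc.FiniteFn q) :
        QuantumDisc.L2nu q) := by
  refine ext_inner_left ℂ fun v => ?_
  -- Both inner products are continuous in `v`, so by density it suffices to test against finite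
  -- functions `g`, where `inner_casimir` applies.
  induction v using UniformSpace.Completion.induction_on with
  | hp => exact isClosed_eq (by fun_prop) (by fun_prop)
  | ih g =>
    -- The scalar `q` is in the linear slot of the inner product, so it comes out unconjugated; the
    -- adjoint then moves onto `g`, and both sides become `-q` times the inner product of `∂̄ g` and
    -- `∂̄ f`.
    rw [UniformSpace.Completion.inner_coe, QuantumDisc.inner_casimir, inner_smul_right,
      QuantumDisc.box, neg_apply, ContinuousLinearMap.comp_apply,
      inner_neg_right, ContinuousLinearMap.adjoint_inner_right, QuantumDisc.dbarL2_coe,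
      QuantumDisc.dbarL2_coe, UniformSpace.Completion.inner_coe, neg_mul, mul_neg]
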